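/- Let $q$ be a prime. For integers $\alpha,\beta\in\{1,\dots,q-1\}$ and a real $\eta\ge 1$ let $$d_{\min}^{(\alpha,\beta)}(\eta)=\min |(\eta w_A+w_B)-(\eta w_A'+w_B')|,$$ the minimum being over all pairs $(w_A,w_B),(w_A',w_B')\in\{0,\dots,q-1\}^2$ with $\alpha w_A+\beta w_B\not\equiv\alpha w_A'+\beta w_B' \pmod q$, and let $$d_q(\eta)=d_{\min}^{opt}(\eta)=\max_{1\le\alpha,\beta\le q-1} d_{\min}^{(\alpha,\beta)}(\eta).$$ An odd turning point (trough) of the curve $\eta\mapsto d_q(\eta)$ on $[1,\infty)$ is a point $\eta\ge1$ at which $d_q$ has a strict local minimum relative to $[1,\infty)$; odd turning points are numbered in increasing order of $\eta$. (a) For every prime $q\ge 3$, $d_q(1)=1$, and the first odd turning point is $\eta=\frac{q}{q-1}$, where $d_q(\eta)=\frac1{q-1}$. (b) For every prime $q\ge 5$, the second odd turning point is $\eta=\frac{2q-3}{2q-5}$, where $d_q(\eta)=\frac{1}{2q-5}$, and $d_q$ is at least $\frac1{2q-5}$ at every odd turning point; that is, the second one has the smallest value of $d_q$ among all odd turning points.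 (c) Consequently $d_q$ collapses near $\eta=1$ as $q$ grows: for every $\varepsilon>0$ there is a $Q$ such that for all primes $q\ge Q$ the second odd turning point $\eta$ exists and satisfies $1<\eta<1+\varepsilon$ and $d_q(\eta)<\varepsilon$. -/

import Mathlib

open Filter Topology

noncomputable section

namespace LinearPNC

/-- A joint symbol `(w_A, w_B)` of `q`-PAM, with `0 ≤ w_A, w_B ≤ q - 1`. -/
abbrev JointSymbol (q : ℕ) : Type := Fin q × Fin q

/-- The network-coded symbol `mod (α w_A + β w_B, q)`. -/
def ncSymbol (q α β : ℕ) (w : JointSymbol q) : ℕ :=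
  (α * (w.1 : ℕ) + β * (w.2 : ℕ)) % q

/-- The superimposed symbol `h_A w_A + h_B w_B`. -/
def superSymbol (q : ℕ) (hA hB : ℝ) (w : JointSymbol q) : ℝ :=
  hA * ((w.1 : ℕ) : ℝ) + hB * ((w.2 : ℕ) : ℝ)

/-- The distances between superimposed symbols of two joint symbols with different
network-coded symbols (two such joint symbols are automatically distinct). -/
def setDistances (q : ℕ) (hA hB : ℝ) (α β : ℕ) : Set ℝ :=
  {d | ∃ w w' : JointSymbol q, ncSymbol q α β w ≠ ncSymbol q α β w' ∧
    d = |superSymbol q hA hB w - superSymbol q hA hB w'|}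

/-- The minimum set distance `d_min` for given channel gains and coefficients. The infimum is a
minimum, see `dmin_isLeast`. -/
def dmin (q : ℕ) (hA hB : ℝ) (α β : ℕ) : ℝ := sInf (setDistances q hA hB α β)

/-- The values of `d_min` over all coefficients `α, β ∈ {1, …, q - 1}`. -/
def dminValues (q : ℕ) (hA hB : ℝ) : Set ℝ :=
  {d | ∃ α β : ℕ, α ∈ Finset.Icc 1 (q - 1) ∧ β ∈ Finset.Icc 1 (q - 1) ∧ d = dmin q hA hB α β}

/-- The optimal minimum set distance as a function of the gain ratio `η = h_A / h_B`, for the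
normalization `h_B = 1`, `h_A = η`. The supremum is a maximum, see `dopt_isGreatest`. -/
def dopt (q : ℕ) (η : ℝ) : ℝ := sSup (dminValues q η 1)

theorem dmin_isLeast {q : ℕ} (hA hB : ℝ) {α β : ℕ}
    (hα : α ∈ Finset.Icc 1 (q - 1)) :
    IsLeast (setDistances q hA hB α β) (dmin q hA hB α β) := by
  rw [Finset.mem_Icc] at hα
  have hfin : (setDistances q hA hB α β).Finite := by
    refine (Set.finite_range (fun p : JointSymbol q × JointSymbol q =>
      |superSymbol q hA hB p.1 - superSymbol q hA hB p.2|)).subset ?_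
    rintro d ⟨w, w', -, rfl⟩
    exact ⟨(w, w'), rfl⟩
  have hne : (setDistances q hA hB α β).Nonempty := by
    refine ⟨_, (⟨1, by omega⟩, ⟨0, by omega⟩), (⟨0, by omega⟩, ⟨0, by omega⟩), ?_, rfl⟩
    simp only [ncSymbol, mul_one, mul_zero, add_zero, Nat.zero_mod]
    rw [Nat.mod_eq_of_lt (by omega)]
    omega
  exact ⟨hne.csInf_mem hfin, fun d hd => csInf_le hfin.bddBelow hd⟩

theorem dopt_isGreatest {q : ℕ} (hq : 2 ≤ q) (η : ℝ) :
    IsGreatest (dminValues q η 1) (dopt q η) := by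
  have hfin : (dminValues q η 1).Finite := by
    refine ((Finset.Icc 1 (q - 1) ×ˢ Finset.Icc 1 (q - 1)).finite_toSet.image
      (fun p : ℕ × ℕ => dmin q η 1 p.1 p.2)).subset ?_
    rintro d ⟨α, β, hα, hβ, rfl⟩
    exact ⟨(α, β), Finset.mem_coe.2 (Finset.mem_product.2 ⟨hα, hβ⟩), rfl⟩
  have hne : (dminValues q η 1).Nonempty :=
    ⟨_, 1, 1, by rw [Finset.mem_Icc]; omega, by rw [Finset.mem_Icc]; omega, rfl⟩
  exact ⟨hne.csSup_mem hfin, fun d hd => le_csSup hfin.bddAbove hd⟩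

/-- An odd turning point (trough) of the curve `η ↦ dopt q η`, `η ≥ 1`: a strict local minimum.
(Points inside an interval on which the curve is constant are not turning points.) -/
def IsOddTurningPoint (q : ℕ) (η : ℝ) : Prop :=
  1 ≤ η ∧ ∀ᶠ x in 𝓝[Set.Ici 1 \ {η}] η, dopt q η < dopt q x

/-- `η` is the `k`-th odd turning point in increasing order, `k = 1, 2, …`: exactly `k - 1` odd
turning points are smaller. -/
def IsNthOddTurningPoint (q k : ℕ) (η : ℝ) : Prop :=
  IsOddTurningPoint q η ∧ {ξ : ℝ | IsOddTurningPoint q ξ ∧ ξ < η}.encard + 1 = k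

end LinearPNC

end

/-!
Differences of joint symbols fill the box `[-(q-1), q-1]²`, and after a sign change in the second
coordinate the condition on network-coded symbols says that the difference `(a, b)` avoids one line
`b ≡ m a (mod q)` with slope `m ≠ 0`; its distance is `|η a - b|`. For `η ≥ 1` a nonzero difference
outside `±[1, q-1]²` has distance at least `1`. So `dopt q η`, where it is less than `1`, is the
second smallest distance of points of `[1, q-1]²`, points on a common line through `0` modulo `q`
being counted once. Both directions of this description are used: two points of nonzero determinant
modulo `q` bound `dopt` from above (`dopt_le_of_two_pairs`), and when `dopt q η < 1` every line is
avoided by a point at distance at most `dopt q η` (`exists_pair_of_dopt_lt_one`).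

With `δ = η - 1`, the points `(1, 1)`, `(q-2, q-1)` and `(q-3, q-2)`, with distances `δ`,
`|1 - (q-2) δ|` and `|1 - (q-3) δ|`, determine the curve up to `η = (2q-3)/(2q-5)`: it equals
`1 - (q-2) δ`, then `δ`, then `1 - (q-3) δ`, the pieces meeting at `δ = 1/(q-1)` (a trough) and
`δ = 1/(q-2)` (a peak).

For the global lower bound, take two points `(a, b)`, `(a', b')` on different lines with distances at
most `d = dopt q η`. The determinant `a b' - a' b` is a nonzero integer and at most `(a + a') d` in
absolute value. One may take `a, a' ≤ q - 2`, not both equal to `q - 2`, so `d ≥ 1/(2q-5)`. Equality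
forces `(2q-5) η = b + b'` to be an integer, so the minimum at `(2q-3)/(2q-5)` is isolated, hence
strict (`dopt_le_imp`).
-/

open LinearPNC

/-! ### Distances of differences -/

theorem ncSymbol_ne_iff {q α β : ℕ} (w w' : JointSymbol q) :
    ncSymbol q α β w ≠ ncSymbol q α β w' ↔
      ¬ (q : ℤ) ∣ (α : ℤ) * (((w.1 : ℕ) : ℤ) - ((w'.1 : ℕ) : ℤ)) +
        (β : ℤ) * (((w.2 : ℕ) : ℤ) - ((w'.2 : ℕ) : ℤ)) := by
  have h : ncSymbol q α β w = ncSymbol q α β w' ↔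
      α * (w'.1 : ℕ) + β * (w'.2 : ℕ) ≡ α * (w.1 : ℕ) + β * (w.2 : ℕ) [MOD q] :=
    ⟨fun h => h.symm, fun h => h.symm⟩
  rw [ne_eq, h, Nat.modEq_iff_dvd]
  push_cast
  rw [show (α : ℤ) * (((w.1 : ℕ) : ℤ) - ((w'.1 : ℕ) : ℤ)) +
        (β : ℤ) * (((w.2 : ℕ) : ℤ) - ((w'.2 : ℕ) : ℤ)) =
      (α : ℤ) * ((w.1 : ℕ) : ℤ) + β * ((w.2 : ℕ) : ℤ) -
        (α * ((w'.1 : ℕ) : ℤ) + β * ((w'.2 : ℕ) : ℤ)) by ring]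

theorem dmin_le_of_not_dvd {q α β : ℕ} (hα : α ∈ Finset.Icc 1 (q - 1)) (η : ℝ) {a b : ℤ}
    (ha : 1 ≤ a) (haq : a ≤ q - 1) (hb : 1 ≤ b) (hbq : b ≤ q - 1)
    (h : ¬ (q : ℤ) ∣ α * a - β * b) : dmin q η 1 α β ≤ |η * a - b| := by
  lift a to ℕ using by omega
  lift b to ℕ using by omega
  apply (dmin_isLeast η 1 hα).2
  refine ⟨(⟨a, by omega⟩, ⟨0, by omega⟩), (⟨0, by omega⟩, ⟨b, by omega⟩), ?_, ?_⟩
  · rw [ncSymbol_ne_iff]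
    simpa [sub_eq_add_neg] using h
  · simp [superSymbol]

/-- No line contains both points, so each choice of coefficients keeps the distance of one of
them. -/
theorem dopt_le_of_two_pairs {q : ℕ} (hq : q.Prime) {η r : ℝ} {a b a' b' : ℤ}
    (ha : 1 ≤ a) (haq : a ≤ q - 1) (hb : 1 ≤ b) (hbq : b ≤ q - 1)
    (ha' : 1 ≤ a') (haq' : a' ≤ q - 1) (hb' : 1 ≤ b') (hbq' : b' ≤ q - 1)
    (hdet : ¬ (q : ℤ) ∣ a * b' - a' * b) (h : |η * a - b| ≤ r) (h' : |η * a' - b'| ≤ r) :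
    dopt q η ≤ r := by
  obtain ⟨α, β, hα, -, hd⟩ := (dopt_isGreatest hq.two_le η).1
  rw [hd]
  by_cases h1 : (q : ℤ) ∣ α * a - β * b
  · by_cases h2 : (q : ℤ) ∣ α * a' - β * b'
    · exfalso
      have h3 : (q : ℤ) ∣ α * (a * b' - a' * b) := by
        have := dvd_sub (h1.mul_left b') (h2.mul_left b)
        rwa [show b' * (α * a - β * b) - b * (α * a' - β * b') = α * (a * b' - a' * b) by ring]
          at this
      rcases (Nat.prime_iff_prime_int.1 hq).dvd_or_dvd h3 with h4 | h4
      · rw [Finset.mem_Icc] at hα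
        have := Nat.le_of_dvd (by omega) (Int.natCast_dvd_natCast.1 h4)
        omega
      · exact hdet h4
    · exact (dmin_le_of_not_dvd hα η ha' haq' hb' hbq' h2).trans h'
  · exact (dmin_le_of_not_dvd hα η ha haq hb hbq h1).trans h

/-- The coefficients `(b₀, a₀)` identify exactly the differences on the line of `(a₀, b₀)`; the
minimum distance for them is attained off that line. -/
theorem exists_pair_of_dopt_lt_one {q : ℕ} (hq : 2 ≤ q) {η : ℝ} (hη : 1 ≤ η)
    (hd : dopt q η < 1) {a₀ b₀ : ℤ} (ha₀ : 1 ≤ a₀) (haq₀ : a₀ ≤ q - 1) (hb₀ : 1 ≤ b₀)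
    (hbq₀ : b₀ ≤ q - 1) :
    ∃ a b : ℤ, 1 ≤ a ∧ a ≤ q - 1 ∧ 1 ≤ b ∧ b ≤ q - 1 ∧ ¬ (q : ℤ) ∣ a * b₀ - a₀ * b ∧
      |η * a - b| ≤ dopt q η := by
  lift a₀ to ℕ using by omega
  lift b₀ to ℕ using by omega
  have hα : b₀ ∈ Finset.Icc 1 (q - 1) := by rw [Finset.mem_Icc]; omega
  have hβ : a₀ ∈ Finset.Icc 1 (q - 1) := by rw [Finset.mem_Icc]; omega
  have hle : dmin q η 1 b₀ a₀ ≤ dopt q η :=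
    (dopt_isGreatest hq η).2 ⟨b₀, a₀, hα, hβ, rfl⟩
  obtain ⟨w, w', hne, hw⟩ := (dmin_isLeast η 1 (β := a₀) hα).1
  rw [ncSymbol_ne_iff] at hne
  have l1 := w.1.2
  have l2 := w.2.2
  have l3 := w'.1.2
  have l4 := w'.2.2
  obtain ⟨a, ha⟩ : ∃ a : ℤ, a = ((w.1 : ℕ) : ℤ) - ((w'.1 : ℕ) : ℤ) := ⟨_, rfl⟩
  obtain ⟨b, hb⟩ : ∃ b : ℤ, b = ((w'.2 : ℕ) : ℤ) - ((w.2 : ℕ) : ℤ) := ⟨_, rfl⟩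
  have hdist : |η * a - b| ≤ dopt q η := by
    rw [hw] at hle
    convert hle using 2
    rw [ha, hb]
    simp only [superSymbol]
    push_cast
    ring
  have hndvd : ¬ (q : ℤ) ∣ a * b₀ - a₀ * b := by
    contrapose! hne
    rw [← ha, show ((w.2 : ℕ) : ℤ) - ((w'.2 : ℕ) : ℤ) = -b by omega]
    rwa [show (b₀ : ℤ) * a + a₀ * -b = a * b₀ - a₀ * b by ring]
  have habs := abs_lt.1 (hdist.trans_lt hd)
  rcases lt_trichotomy a 0 with h0 | h0 | h0
  · have h1 : (a : ℝ) ≤ -1 := by exact_mod_cast (show a ≤ -1 by omega)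
    have h2 : b < 0 := by
      by_contra! h
      have : (0 : ℝ) ≤ b := by exact_mod_cast h
      nlinarith
    refine ⟨-a, -b, by omega, by omega, by omega, by omega, ?_, ?_⟩
    · rw [show -a * (b₀ : ℤ) - a₀ * -b = -(a * b₀ - a₀ * b) by ring, dvd_neg]
      exact hndvd
    · push_cast
      rw [show η * -(a : ℝ) - -b = -(η * a - b) by ring, abs_neg]
      exact hdist
  · have h1 : b = 0 := by
      rw [h0] at habs
      have h2 : (b : ℝ) < 1 := by push_cast at habs; linarith
      have h3 : (-1 : ℝ) < b := by push_cast at habs; linarith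
      have h2' : b < 1 := by exact_mod_cast h2
      have h3' : -1 < b := by exact_mod_cast h3
      omega
    exact absurd (by simp [h0, h1]) hndvd
  · have h1 : (1 : ℝ) ≤ a := by exact_mod_cast h0
    have h2 : 0 < b := by
      by_contra! h
      have : (b : ℝ) ≤ 0 := by exact_mod_cast h
      nlinarith
    exact ⟨a, b, by omega, by omega, by omega, by omega, hndvd, hdist⟩

/-! ### The curve up to the second trough -/

theorem not_natCast_dvd_of_eq_one {q : ℕ} (hq : 2 ≤ q) {n : ℤ} (hn : n = 1) :
    ¬ (q : ℤ) ∣ n := by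
  intro h
  have := Int.le_of_dvd (by omega) h
  omega

theorem dopt_eq_of_le_first {q : ℕ} (hq : q.Prime) (hq3 : 3 ≤ q) {η : ℝ} (hη : 1 ≤ η)
    (h : ((q : ℝ) - 1) * (η - 1) ≤ 1) : dopt q η = 1 - ((q : ℝ) - 2) * (η - 1) := by
  have hqr : (3 : ℝ) ≤ q := by exact_mod_cast hq3
  apply le_antisymm
  · refine dopt_le_of_two_pairs hq (a := 1) (b := 1) (a' := q - 2) (b' := q - 1)
      (by omega) (by omega) (by omega) (by omega) (by omega) (by omega) (by omega) (by omega)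
      (not_natCast_dvd_of_eq_one (by omega) (by ring)) ?_ ?_
    · push_cast
      rw [abs_le]
      constructor <;> nlinarith
    · push_cast
      rw [abs_le]
      constructor <;> nlinarith
  · by_contra! hlt
    have hlt1 : dopt q η < 1 := by nlinarith
    obtain ⟨a, b, ha, haq, hb, hbq, hnd, hab⟩ := exists_pair_of_dopt_lt_one hq.two_le hη hlt1
      (a₀ := 1) (b₀ := 1) (by omega) (by omega) (by omega) (by omega)
    have hne : a ≠ b := by
      rintro rfl
      exact hnd (by simp)
    have har : (1 : ℝ) ≤ a := by exact_mod_cast ha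
    rw [abs_le] at hab
    rcases lt_or_gt_of_ne hne with h' | h'
    · have h1 : (a : ℝ) + 1 ≤ b := by exact_mod_cast h'
      have h2 : (a : ℝ) ≤ q - 2 := by
        have : a ≤ (q : ℤ) - 2 := by omega
        exact_mod_cast this
      nlinarith
    · have h1 : (b : ℝ) + 1 ≤ a := by exact_mod_cast h'
      nlinarith

/-- The line of `(q - 2, q - 1)` is the one to avoid: off it, a point with `b > a` has
`a ≤ q - 3`. -/
theorem min_le_dopt {q : ℕ} (hq3 : 3 ≤ q) {η : ℝ} (hη : 1 ≤ η) :
    min (η - 1) (1 - ((q : ℝ) - 3) * (η - 1)) ≤ dopt q η := by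
  have hqr : (3 : ℝ) ≤ q := by exact_mod_cast hq3
  by_contra! hlt
  obtain ⟨hlt1, hlt2⟩ := lt_min_iff.1 hlt
  obtain ⟨a, b, ha, haq, hb, hbq, hnd, hab⟩ := exists_pair_of_dopt_lt_one
    (show 2 ≤ q by omega) hη (by nlinarith)
    (a₀ := q - 2) (b₀ := q - 1) (by omega) (by omega) (by omega) (by omega)
  have har : (1 : ℝ) ≤ a := by exact_mod_cast ha
  rw [abs_le] at hab
  rcases le_or_gt b a with h' | h'
  · have h1 : (b : ℝ) ≤ a := by exact_mod_cast h'
    nlinarith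
  · have h1 : (a : ℝ) + 1 ≤ b := by exact_mod_cast h'
    have h2 : a ≤ (q : ℤ) - 3 := by
      by_contra! h
      obtain rfl : a = q - 2 := by omega
      obtain rfl : b = q - 1 := by omega
      exact hnd (by simp)
    have h3 : (a : ℝ) ≤ q - 3 := by exact_mod_cast h2
    nlinarith

theorem dopt_eq_of_first_le {q : ℕ} (hq : q.Prime) (hq3 : 3 ≤ q) {η : ℝ}
    (h : 1 ≤ ((q : ℝ) - 1) * (η - 1)) (h' : ((q : ℝ) - 2) * (η - 1) ≤ 1) :
    dopt q η = η - 1 := by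
  have hqr : (3 : ℝ) ≤ q := by exact_mod_cast hq3
  have hη : 1 ≤ η := by nlinarith
  apply le_antisymm
  · refine dopt_le_of_two_pairs hq (a := 1) (b := 1) (a' := q - 2) (b' := q - 1)
      (by omega) (by omega) (by omega) (by omega) (by omega) (by omega) (by omega) (by omega)
      (not_natCast_dvd_of_eq_one (by omega) (by ring)) ?_ ?_
    · push_cast
      rw [abs_le]
      constructor <;> nlinarith
    · push_cast
      rw [abs_le]
      constructor <;> nlinarith
  · refine le_trans (le_min le_rfl ?_) (min_le_dopt hq3 hη)
    nlinarith

theorem dopt_eq_of_le_second {q : ℕ} (hq : q.Prime) (hq5 : 5 ≤ q) {η : ℝ}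
    (h : 1 ≤ ((q : ℝ) - 2) * (η - 1)) (h' : (2 * (q : ℝ) - 5) * (η - 1) ≤ 2) :
    dopt q η = 1 - ((q : ℝ) - 3) * (η - 1) := by
  have hqr : (5 : ℝ) ≤ q := by exact_mod_cast hq5
  have hη : 1 ≤ η := by nlinarith
  apply le_antisymm
  · refine dopt_le_of_two_pairs hq (a := q - 3) (b := q - 2) (a' := q - 2) (b' := q - 1)
      (by omega) (by omega) (by omega) (by omega) (by omega) (by omega) (by omega) (by omega) ?_
      ?_ ?_
    · have h1 : ((q : ℤ) - 3) * (q - 1) - (q - 2) * (q - 2) = -1 := by ring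
      rw [h1, dvd_neg]
      exact not_natCast_dvd_of_eq_one (by omega) rfl
    · push_cast
      rw [abs_le]
      constructor <;> nlinarith
    · push_cast
      rw [abs_le]
      constructor <;> nlinarith
  · refine le_trans (le_min ?_ le_rfl) (min_le_dopt (by omega) hη)
    nlinarith

/-! ### The global lower bound -/

/-- A point with `a = q - 1` at distance less than `1` is `(q - 1, q - 1)`, and `(1, 1)` is on the
same line and no farther. -/
theorem exists_pair_of_dopt_lt_one_of_le {q : ℕ} (hq3 : 3 ≤ q) {η : ℝ} (hη : 1 ≤ η)
    (hd : dopt q η < 1) {a₀ b₀ : ℤ} (ha₀ : 1 ≤ a₀) (haq₀ : a₀ ≤ q - 1) (hb₀ : 1 ≤ b₀)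
    (hbq₀ : b₀ ≤ q - 1) :
    ∃ a b : ℤ, 1 ≤ a ∧ a ≤ q - 2 ∧ 1 ≤ b ∧ b ≤ q - 1 ∧ ¬ (q : ℤ) ∣ a * b₀ - a₀ * b ∧
      |η * a - b| ≤ dopt q η := by
  obtain ⟨a, b, ha, haq, hb, hbq, hnd, hab⟩ :=
    exists_pair_of_dopt_lt_one (show 2 ≤ q by omega) hη hd ha₀ haq₀ hb₀ hbq₀
  rcases le_or_gt a ((q : ℤ) - 2) with h | h
  · exact ⟨a, b, ha, h, hb, hbq, hnd, hab⟩
  · have hqr : (3 : ℝ) ≤ q := by exact_mod_cast hq3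
    obtain rfl : a = q - 1 := by omega
    have hbe : b = q - 1 := by
      by_contra hne
      have h1 : (b : ℝ) ≤ q - 2 := by
        have : b ≤ (q : ℤ) - 2 := by omega
        exact_mod_cast this
      have h2 := (abs_le.1 hab).2
      push_cast at h2
      nlinarith
    subst hbe
    refine ⟨1, 1, by omega, by omega, by omega, by omega, ?_, ?_⟩
    · contrapose! hnd
      have := hnd.mul_left ((q : ℤ) - 1)
      rwa [show ((q : ℤ) - 1) * (1 * b₀ - a₀ * 1) = (q - 1) * b₀ - a₀ * (q - 1) by ring] at this
    · refine le_trans ?_ hab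
      push_cast
      rw [abs_of_nonneg (by linarith), abs_of_nonneg (by nlinarith)]
      nlinarith

/-- The value `1 / (2q - 5)` is the least possible, and it occurs only at isolated points. -/
theorem dopt_le_imp {q : ℕ} (hq5 : 5 ≤ q) {η : ℝ} (hη : 1 ≤ η)
    (hd : dopt q η ≤ 1 / (2 * (q : ℝ) - 5)) :
    dopt q η = 1 / (2 * (q : ℝ) - 5) ∧ ∃ n : ℤ, (2 * (q : ℝ) - 5) * η = n := by
  have hqr : (5 : ℝ) ≤ q := by exact_mod_cast hq5
  have hpos : 0 < 2 * (q : ℝ) - 5 := by linarith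
  have hd' : (2 * (q : ℝ) - 5) * dopt q η ≤ 1 := by
    rwa [le_div_iff₀ hpos, mul_comm] at hd
  have hd2 : dopt q η < 1 / 2 := by
    by_contra! h
    nlinarith
  obtain ⟨a, b, ha, haq, hb, hbq, -, hab⟩ := exists_pair_of_dopt_lt_one_of_le
    (show 3 ≤ q by omega) hη (by linarith) (a₀ := 1) (b₀ := 1)
    (by omega) (by omega) (by omega) (by omega)
  obtain ⟨a', b', ha', haq', hb', hbq', hnd, hab'⟩ := exists_pair_of_dopt_lt_one_of_le
    (show 3 ≤ q by omega) hη (by linarith) (a₀ := a) (b₀ := b)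
    (by omega) (by omega) (by omega) (by omega)
  have hdet : a' * b - a * b' ≠ 0 := fun h => hnd (by simp [h])
  generalize dopt q η = d at *
  rw [abs_le] at hab hab'
  have hsum : a + a' ≤ 2 * q - 5 := by
    by_contra! h
    obtain rfl : a = q - 2 := by omega
    obtain rfl : a' = q - 2 := by omega
    apply hdet
    have h1 : (b : ℝ) < b' + 1 := by linarith [hab.1, hab'.2]
    have h2 : (b' : ℝ) < b + 1 := by linarith [hab'.1, hab.2]
    have h1' : b < b' + 1 := by exact_mod_cast h1
    have h2' : b' < b + 1 := by exact_mod_cast h2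
    rw [show b = b' by omega, sub_self]
  have har : (1 : ℝ) ≤ a := by exact_mod_cast ha
  have har' : (1 : ℝ) ≤ a' := by exact_mod_cast ha'
  have hsumr : (a : ℝ) + a' ≤ 2 * q - 5 := by exact_mod_cast hsum
  have hd0 : 0 ≤ d := by linarith [hab.1, hab.2]
  -- the four slacks in the bounds of the two distances, weighted by `a` and `a'`
  have m1 := mul_nonneg (zero_le_one.trans har') (sub_nonneg.2 hab.1)
  have m2 := mul_nonneg (zero_le_one.trans har') (sub_nonneg.2 hab.2)
  have m3 := mul_nonneg (zero_le_one.trans har) (sub_nonneg.2 hab'.1)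
  have m4 := mul_nonneg (zero_le_one.trans har) (sub_nonneg.2 hab'.2)
  have m5 := mul_nonneg (sub_nonneg.2 hsumr) hd0
  have key : 1 ≤ ((a : ℝ) + a') * d := by
    rcases lt_or_gt_of_ne hdet with h | h
    · have : (a' : ℝ) * b - a * b' ≤ -1 := by exact_mod_cast (show _ ≤ (-1 : ℤ) by omega)
      linarith
    · have : (1 : ℝ) ≤ (a' : ℝ) * b - a * b' := by exact_mod_cast h
      linarith
  have hde : (2 * (q : ℝ) - 5) * d = 1 := by linarith
  have hdpos : 0 < d := by
    by_contra! h
    nlinarith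
  have hsume : (a : ℝ) + a' = 2 * q - 5 := by
    by_contra hne
    have := mul_pos (sub_pos.2 (lt_of_le_of_ne hsumr hne)) hdpos
    linarith
  have hkey : ((a : ℝ) + a') * d = 1 := by rw [hsume, hde]
  refine ⟨by rw [eq_div_iff hpos.ne', mul_comm]; exact hde, b + b', ?_⟩
  push_cast
  -- equality holds in the determinant bound, so the errors are `d` and `-d`, and cancel
  rcases lt_or_gt_of_ne hdet with h | h
  · have : (a' : ℝ) * b - a * b' ≤ -1 := by exact_mod_cast (show _ ≤ (-1 : ℤ) by omega)
    have e1 : η * a - b = d := by nlinarith [hab.2, hab'.1]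
    have e2 : η * a' - b' = -d := by nlinarith [hab.2, hab'.1]
    rw [← hsume]
    linarith
  · have : (1 : ℝ) ≤ (a' : ℝ) * b - a * b' := by exact_mod_cast h
    have e1 : η * a - b = -d := by nlinarith [hab.1, hab'.2]
    have e2 : η * a' - b' = d := by nlinarith [hab.1, hab'.2]
    rw [← hsume]
    linarith

theorem one_div_le_dopt {q : ℕ} (hq5 : 5 ≤ q) {η : ℝ} (hη : 1 ≤ η) :
    1 / (2 * (q : ℝ) - 5) ≤ dopt q η := by
  by_contra! h
  exact h.ne (dopt_le_imp hq5 hη h.le).1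

/-! ### Turning points -/

theorem LinearPNC.IsOddTurningPoint.exists_gt {q : ℕ} {η ζ : ℝ} (h : IsOddTurningPoint q η)
    (hζ : η < ζ) : ∃ x, η < x ∧ x < ζ ∧ dopt q η < dopt q x := by
  have h1 : 𝓝[>] η ≤ 𝓝[Set.Ici 1 \ {η}] η :=
    nhdsWithin_mono _ fun x hx => ⟨h.1.trans (le_of_lt hx), ne_of_gt hx⟩
  obtain ⟨x, hx, hx'⟩ := ((h.2.filter_mono h1).and (Ioo_mem_nhdsGT hζ)).exists
  exact ⟨x, hx'.1, hx'.2, hx⟩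

theorem LinearPNC.IsOddTurningPoint.exists_lt {q : ℕ} {η ζ : ℝ} (h : IsOddTurningPoint q η)
    (hζ : ζ < η) (hζ1 : 1 ≤ ζ) : ∃ x, ζ < x ∧ x < η ∧ dopt q η < dopt q x := by
  have h1 : 𝓝[<] η ≤ 𝓝[Set.Ici 1 \ {η}] η := by
    rw [← nhdsWithin_Ioo_eq_nhdsLT hζ]
    exact nhdsWithin_mono _ fun x hx => ⟨hζ1.trans hx.1.le, ne_of_lt hx.2⟩
  obtain ⟨x, hx, hx'⟩ := ((h.2.filter_mono h1).and (Ioo_mem_nhdsLT hζ)).exists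
  exact ⟨x, hx'.1, hx'.2, hx⟩

theorem dopt_first {q : ℕ} (hq : q.Prime) (hq3 : 3 ≤ q) :
    dopt q ((q : ℝ) / ((q : ℝ) - 1)) = 1 / ((q : ℝ) - 1) := by
  have hqr : (3 : ℝ) ≤ q := by exact_mod_cast hq3
  have hpos : (0 : ℝ) < q - 1 := by linarith
  have e : (q : ℝ) / ((q : ℝ) - 1) - 1 = 1 / ((q : ℝ) - 1) := by field_simp; ring
  rw [dopt_eq_of_first_le hq hq3, e]
  · rw [e, mul_one_div_cancel hpos.ne']
  · rw [e, mul_one_div, div_le_one hpos]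
    linarith

theorem isOddTurningPoint_first {q : ℕ} (hq : q.Prime) (hq3 : 3 ≤ q) :
    IsOddTurningPoint q ((q : ℝ) / ((q : ℝ) - 1)) := by
  have hqr : (3 : ℝ) ≤ q := by exact_mod_cast hq3
  have hpos : (0 : ℝ) < q - 1 := by linarith
  have hpos2 : (0 : ℝ) < q - 2 := by linarith
  have hmul : ((q : ℝ) - 1) * ((q : ℝ) / ((q : ℝ) - 1)) = q := mul_div_cancel₀ _ hpos.ne'
  have hval : ((q : ℝ) - 1) * dopt q ((q : ℝ) / ((q : ℝ) - 1)) = 1 := by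
    rw [dopt_first hq hq3, mul_one_div_cancel hpos.ne']
  have hlt : (q : ℝ) / ((q : ℝ) - 1) < 1 + 1 / ((q : ℝ) - 2) := by
    have : (q : ℝ) / ((q : ℝ) - 1) = 1 + 1 / ((q : ℝ) - 1) := by field_simp; ring
    rw [this]
    gcongr
    linarith
  refine ⟨by rw [le_div_iff₀ hpos]; linarith, ?_⟩
  filter_upwards [self_mem_nhdsWithin, mem_nhdsWithin_of_mem_nhds (Iio_mem_nhds hlt)] with x hx hx'
  have hx1 : 1 ≤ x := hx.1
  have hx2 : ((q : ℝ) - 2) * (x - 1) ≤ 1 := by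
    have : x - 1 < 1 / ((q : ℝ) - 2) := by linarith [Set.mem_Iio.1 hx']
    rw [lt_div_iff₀ hpos2] at this
    linarith
  generalize (q : ℝ) / ((q : ℝ) - 1) = η at *
  rcases lt_or_gt_of_ne (show x ≠ η from hx.2) with h | h
  · rw [dopt_eq_of_le_first hq hq3 hx1 (by nlinarith)]
    nlinarith
  · rw [dopt_eq_of_first_le hq hq3 (by nlinarith) hx2]
    nlinarith

theorem not_isOddTurningPoint_of_lt_first {q : ℕ} (hq : q.Prime) (hq3 : 3 ≤ q) {η : ℝ}
    (h : η < (q : ℝ) / ((q : ℝ) - 1)) : ¬ IsOddTurningPoint q η := by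
  intro ht
  have hqr : (3 : ℝ) ≤ q := by exact_mod_cast hq3
  have hpos : (0 : ℝ) < q - 1 := by linarith
  obtain ⟨x, hx1, hx2, hx⟩ := ht.exists_gt h
  rw [lt_div_iff₀ hpos] at h hx2
  have h1 := ht.1
  rw [dopt_eq_of_le_first hq hq3 h1 (by linarith),
    dopt_eq_of_le_first hq hq3 (by linarith) (by linarith)] at hx
  nlinarith

theorem isNthOddTurningPoint_first {q : ℕ} (hq : q.Prime) (hq3 : 3 ≤ q) :
    IsNthOddTurningPoint q 1 ((q : ℝ) / ((q : ℝ) - 1)) := by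
  refine ⟨isOddTurningPoint_first hq hq3, ?_⟩
  have : {ξ : ℝ | IsOddTurningPoint q ξ ∧ ξ < (q : ℝ) / ((q : ℝ) - 1)} = ∅ :=
    Set.eq_empty_of_forall_notMem fun ξ hξ => not_isOddTurningPoint_of_lt_first hq hq3 hξ.2 hξ.1
  rw [this]
  simp

theorem dopt_second {q : ℕ} (hq : q.Prime) (hq5 : 5 ≤ q) :
    dopt q ((2 * (q : ℝ) - 3) / (2 * (q : ℝ) - 5)) = 1 / (2 * (q : ℝ) - 5) := by
  have hqr : (5 : ℝ) ≤ q := by exact_mod_cast hq5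
  have hpos : 0 < 2 * (q : ℝ) - 5 := by linarith
  have e : (2 * (q : ℝ) - 3) / (2 * (q : ℝ) - 5) - 1 = 2 / (2 * (q : ℝ) - 5) := by
    field_simp; ring
  rw [dopt_eq_of_le_second hq hq5, e]
  · rw [eq_div_iff hpos.ne', sub_mul, mul_assoc, div_mul_cancel₀ _ hpos.ne']
    ring
  · rw [e, mul_div_assoc', le_div_iff₀ hpos]
    linarith
  · rw [e, mul_div_cancel₀ _ hpos.ne']

theorem isOddTurningPoint_second {q : ℕ} (hq : q.Prime) (hq5 : 5 ≤ q) :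
    IsOddTurningPoint q ((2 * (q : ℝ) - 3) / (2 * (q : ℝ) - 5)) := by
  have hqr : (5 : ℝ) ≤ q := by exact_mod_cast hq5
  have hpos : 0 < 2 * (q : ℝ) - 5 := by linarith
  refine ⟨by rw [le_div_iff₀ hpos]; linarith, ?_⟩
  rw [dopt_second hq hq5]
  have hmul : (2 * (q : ℝ) - 5) * ((2 * (q : ℝ) - 3) / (2 * (q : ℝ) - 5)) = 2 * q - 3 :=
    mul_div_cancel₀ _ hpos.ne'
  filter_upwards [self_mem_nhdsWithin, mem_nhdsWithin_of_mem_nhds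
    (Metric.ball_mem_nhds _ (one_div_pos.2 hpos))] with x hx hx'
  by_contra! hle
  obtain ⟨-, n, hn⟩ := dopt_le_imp hq5 hx.1 hle
  rw [Metric.mem_ball, Real.dist_eq, lt_div_iff₀ hpos, ← abs_of_pos hpos, ← abs_mul, abs_lt,
    abs_of_pos hpos, sub_mul, mul_comm x, mul_comm (_ / _), hmul, hn] at hx'
  have h1 : n < 2 * (q : ℤ) - 3 + 1 := by
    have : (n : ℝ) < 2 * (q : ℝ) - 3 + 1 := by linarith
    exact_mod_cast this
  have h2 : 2 * (q : ℤ) - 3 < n + 1 := by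
    have : 2 * (q : ℝ) - 3 < (n : ℝ) + 1 := by linarith
    exact_mod_cast this
  obtain rfl : n = 2 * q - 3 := by omega
  apply hx.2
  rw [Set.mem_singleton_iff, eq_div_iff hpos.ne', mul_comm, hn]
  push_cast
  ring

theorem not_isOddTurningPoint_of_lt_second {q : ℕ} (hq : q.Prime) (hq5 : 5 ≤ q) {η : ℝ}
    (h : (q : ℝ) / ((q : ℝ) - 1) < η) (h' : η < (2 * (q : ℝ) - 3) / (2 * (q : ℝ) - 5)) :
    ¬ IsOddTurningPoint q η := by
  intro ht
  have hqr : (5 : ℝ) ≤ q := by exact_mod_cast hq5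
  have hpos : 0 < 2 * (q : ℝ) - 5 := by linarith
  have hpos1 : (0 : ℝ) < q - 1 := by linarith
  -- `(q - 2)(η - 1) = 1` is the peak between the two troughs
  rcases le_or_gt (((q : ℝ) - 2) * (η - 1)) 1 with hc | hc
  · obtain ⟨x, hx1, hx2, hx⟩ :=
      ht.exists_lt h (by rw [le_div_iff₀ hpos1]; linarith)
    rw [div_lt_iff₀ hpos1] at h hx1
    rw [dopt_eq_of_first_le hq (by omega) (by linarith) hc,
      dopt_eq_of_first_le hq (by omega) (by linarith) (by nlinarith)] at hx
    linarith
  · obtain ⟨x, hx1, hx2, hx⟩ := ht.exists_gt h'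
    rw [lt_div_iff₀ hpos] at h' hx2
    rw [dopt_eq_of_le_second hq hq5 hc.le (by linarith),
      dopt_eq_of_le_second hq hq5 (by nlinarith) (by linarith)] at hx
    nlinarith

theorem isNthOddTurningPoint_second {q : ℕ} (hq : q.Prime) (hq5 : 5 ≤ q) :
    IsNthOddTurningPoint q 2 ((2 * (q : ℝ) - 3) / (2 * (q : ℝ) - 5)) := by
  refine ⟨isOddTurningPoint_second hq hq5, ?_⟩
  have hqr : (5 : ℝ) ≤ q := by exact_mod_cast hq5
  have : {ξ : ℝ | IsOddTurningPoint q ξ ∧ ξ < (2 * (q : ℝ) - 3) / (2 * (q : ℝ) - 5)} =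
      {(q : ℝ) / ((q : ℝ) - 1)} := by
    ext ξ
    simp only [Set.mem_ofPred_eq, Set.mem_singleton_iff]
    constructor
    · rintro ⟨h1, h2⟩
      rcases lt_trichotomy ξ ((q : ℝ) / ((q : ℝ) - 1)) with h | h | h
      · exact absurd h1 (not_isOddTurningPoint_of_lt_first hq (by omega) h)
      · exact h
      · exact absurd h1 (not_isOddTurningPoint_of_lt_second hq hq5 h h2)
    · rintro rfl
      refine ⟨isOddTurningPoint_first hq (by omega), ?_⟩
      rw [div_lt_div_iff₀ (by linarith) (by linarith)]
      nlinarith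
  rw [this, Set.encard_singleton]
  norm_num

theorem corollary5 :
    -- the curve starts at the value 1, and its first trough
    (∀ q : ℕ, q.Prime → 3 ≤ q →
      LinearPNC.dopt q 1 = 1 ∧
      LinearPNC.IsNthOddTurningPoint q 1 ((q : ℝ) / ((q : ℝ) - 1)) ∧
      LinearPNC.dopt q ((q : ℝ) / ((q : ℝ) - 1)) = 1 / ((q : ℝ) - 1)) ∧
    -- the second trough, which is a lowest one
    (∀ q : ℕ, q.Prime → 5 ≤ q →
      LinearPNC.IsNthOddTurningPoint q 2 ((2 * (q : ℝ) - 3) / (2 * (q : ℝ) - 5)) ∧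
      LinearPNC.dopt q ((2 * (q : ℝ) - 3) / (2 * (q : ℝ) - 5)) = 1 / (2 * (q : ℝ) - 5) ∧
      ∀ η : ℝ, LinearPNC.IsOddTurningPoint q η → 1 / (2 * (q : ℝ) - 5) ≤ LinearPNC.dopt q η) ∧
    -- the collapse near 1
    (∀ ε : ℝ, 0 < ε → ∃ Q : ℕ, ∀ q : ℕ, q.Prime → Q ≤ q →
      ∃ η : ℝ, LinearPNC.IsNthOddTurningPoint q 2 η ∧ 1 < η ∧ η < 1 + ε ∧
        LinearPNC.dopt q η < ε) := by
  refine ⟨fun q hq hq3 => ⟨?_, isNthOddTurningPoint_first hq hq3, dopt_first hq hq3⟩,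
    fun q hq hq5 => ⟨isNthOddTurningPoint_second hq hq5, dopt_second hq hq5,
      fun η h => one_div_le_dopt hq5 h.1⟩, fun ε hε => ?_⟩
  · rw [dopt_eq_of_le_first hq hq3 le_rfl (by simp)]
    simp
  · obtain ⟨N, hN⟩ := exists_nat_gt (2 / ε)
    refine ⟨N + 5, fun q hq hQ => ⟨_, isNthOddTurningPoint_second hq (by omega), ?_⟩⟩
    have hqr : (N : ℝ) + 5 ≤ q := by exact_mod_cast hQ
    have hN0 : (0 : ℝ) ≤ N := N.cast_nonneg
    have hpos : 0 < 2 * (q : ℝ) - 5 := by linarith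
    rw [div_lt_iff₀ hε] at hN
    -- `2q - 5 ≥ N`, and `N ε > 2`
    have hbig : 2 < (2 * (q : ℝ) - 5) * ε := by nlinarith
    rw [dopt_second hq (by omega)]
    refine ⟨?_, ?_, ?_⟩
    · rw [lt_div_iff₀ hpos]
      linarith
    · rw [div_lt_iff₀ hpos]
      linarith
    · rw [div_lt_iff₀ hpos]
      linarith
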